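/- Let $N\ge 0$ be an integer, $y\in\mathbb R$, and let $a$ be a real- or complex-valued function on $\mathbb R$ such that $\int_{-\infty}^y |a(\lambda)|\,|\lambda|^k e^{-2\lambda^2}\,d\lambda<\infty$ for all integers $0\le k\le 4N-4$ (these integrands being measurable). Let $$Z_{4,N}=\int_{\mathbb R^N}\prod_{j=1}^N e^{-2\lambda_j^2}\prod_{j<k}|\lambda_k-\lambda_j|^4\,d\lambda_1\cdots d\lambda_N$$ be the normalization constant of the GSE eigenvalue density, and let $$\hat Z_{4,N}[a,y]=\frac1{Z_{4,N}}\int_{-\infty}^y d\lambda_1\cdots\int_{-\infty}^y d\lambda_N\ \prod_{j=1}^N a(\lambda_j)\,e^{-2\lambda_j^2}\prod_{j<k}|\lambda_k-\lambda_j|^4 .$$ Let $Q_0,Q_1,Q_2,\dots$ be real monic polynomials with $\deg Q_j=j$ that are skew-orthogonal with respect to $$\langle f,g\rangle_4^y=\frac12\int_{-\infty}^y e^{-2x^2}\bigl[f(x)g'(x)-g(x)f'(x)\bigr]\,dx ,$$ that is, $\langle Q_{2j},Q_{2k}\rangle_4^y=\langle Q_{2j+1},Q_{2k+1}\rangle_4^y=0$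 for all $j,k\ge0$, and $\langle Q_{2j},Q_{2k+1}\rangle_4^y=-\langle Q_{2k+1},Q_{2j}\rangle_4^y=0$ for $j\ne k$. Put $$\gamma^{(4)}_{j,k}[a,y]=\frac12\int_{-\infty}^y a(\lambda)e^{-\lambda^2}\Bigl[Q_j(\lambda)\frac{d}{d\lambda}\bigl(e^{-\lambda^2}Q_k(\lambda)\bigr)-Q_k(\lambda)\frac{d}{d\lambda}\bigl(e^{-\lambda^2}Q_j(\lambda)\bigr)\Bigr]d\lambda .$$ Then $Z_{4,N}>0$, the integrals defining $\hat Z_{4,N}[a,y]$ and $\gamma^{(4)}_{j,k}[a,y]$ ($0\le j,k\le 2N-1$) converge absolutely, and $$\hat Z_{4,N}[a,y]=\frac{N!\,2^N}{Z_{4,N}}\ \mathrm{Pf}\bigl[\gamma^{(4)}_{j,k}[a,y]\bigr]_{j,k=0,\dots,2N-1},$$ where, for an antisymmetric $2N\times2N$ matrix $M=[m_{j,k}]$, $\mathrm{Pf}\,M=\frac1{2^NN!}\sum_{P\in S_{2N}}\varepsilon(P)\prod_{j=1}^N m_{P(2j-1),P(2j)}$. -/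

import Mathlib

open MeasureTheory
open scoped Polynomial Nat

noncomputable section

namespace GaussianEnsemble

/-- The Pfaffian of an (antisymmetric) `2N × 2N` matrix,
`Pf M = (1 / (2^N N!)) ∑_{P ∈ S_{2N}} ε(P) m_{P(1),P(2)} m_{P(3),P(4)} ⋯ m_{P(2N-1),P(2N)}`,
with rows and columns numbered from `0`. -/
def pfaffian {K : Type*} [Field K] {N : ℕ} (M : Matrix (Fin (2 * N)) (Fin (2 * N)) K) : K :=
  1 / (2 ^ N * (N ! : K)) *
    ∑ P : Equiv.Perm (Fin (2 * N)), ((Equiv.Perm.sign P : ℤ) : K) *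
      ∏ i : Fin N, M (P ⟨2 * i.1, by omega⟩) (P ⟨2 * i.1 + 1, by omega⟩)

/-- The unnormalised joint density of the eigenvalues of the Gaussian `β`-ensemble,
`∏_j e^{-β x_j² / 2} ∏_{j<k} |x_k - x_j|^β`. -/
def eigenvalueWeight (β N : ℕ) (x : Fin N → ℝ) : ℝ :=
  (∏ j, Real.exp (-((β : ℝ) * x j ^ 2 / 2))) *
    ∏ j, ∏ k ∈ Finset.Ioi j, |x k - x j| ^ β

/-- The normalisation constant `Z_{β,N}` of the joint eigenvalue density. -/
def partitionZ (β N : ℕ) : ℝ :=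
  ∫ x : Fin N → ℝ, eigenvalueWeight β N x

/-- The integrand `∏_j a(x_j) e^{-β x_j² / 2} ∏_{j<k} |x_k - x_j|^β` of the restricted average. -/
def averageIntegrand {𝕜 : Type*} [RCLike 𝕜] (β N : ℕ) (a : ℝ → 𝕜) (x : Fin N → ℝ) : 𝕜 :=
  (∏ j, a (x j)) * (eigenvalueWeight β N x : 𝕜)

/-- The domain `(-∞, y]^N`. -/
def cutoffBox (N : ℕ) (y : ℝ) : Set (Fin N → ℝ) :=
  Set.univ.pi fun _ => Set.Iic y

/-- The restricted average `Ẑ_{β,N}[a, y]`. -/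
def restrictedAverage {𝕜 : Type*} [RCLike 𝕜] (β N : ℕ) (a : ℝ → 𝕜) (y : ℝ) : 𝕜 :=
  ((1 / partitionZ β N : ℝ) : 𝕜) * ∫ x in cutoffBox N y, averageIntegrand β N a x

/-- The skew-inner product for `β = 4`, truncated at `y`:
`⟨f, g⟩ = (1/2) ∫_{-∞}^y e^{-2x²} (f(x) g'(x) - g(x) f'(x)) dx`. -/
def skewInner4 (y : ℝ) (f g : ℝ[X]) : ℝ :=
  1 / 2 * ∫ x in Set.Iic y, Real.exp (-(2 * x ^ 2)) *
    (f.eval x * g.derivative.eval x - g.eval x * f.derivative.eval x)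

/-- `Q_0, Q_1, …` are monic, `Q_j` has degree `j`, and they are skew-orthogonal for the `β = 4`
skew-inner product truncated at `y`. -/
structure IsMonicSkewOrthogonal4 (y : ℝ) (Q : ℕ → ℝ[X]) : Prop where
  monic : ∀ j, (Q j).Monic
  natDegree_eq : ∀ j, (Q j).natDegree = j
  even_even : ∀ j k, skewInner4 y (Q (2 * j)) (Q (2 * k)) = 0
  odd_odd : ∀ j k, skewInner4 y (Q (2 * j + 1)) (Q (2 * k + 1)) = 0
  even_odd : ∀ j k, j ≠ k → skewInner4 y (Q (2 * j)) (Q (2 * k + 1)) = 0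
  odd_even : ∀ j k, j ≠ k → skewInner4 y (Q (2 * k + 1)) (Q (2 * j)) = 0

/-- The integrand of `γ⁽⁴⁾` for the polynomials `f`, `g`:
`a(x) e^{-x²} [f(x) d/dx (e^{-x²} g(x)) - g(x) d/dx (e^{-x²} f(x))]`. -/
def gammaIntegrand4 {𝕜 : Type*} [RCLike 𝕜] (a : ℝ → 𝕜) (f g : ℝ[X]) (x : ℝ) : 𝕜 :=
  a x * ((Real.exp (-x ^ 2) *
    (f.eval x * deriv (fun t => Real.exp (-t ^ 2) * g.eval t) x -
      g.eval x * deriv (fun t => Real.exp (-t ^ 2) * f.eval t) x) : ℝ) : 𝕜)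

/-- The entry `γ⁽⁴⁾[a, y]` belonging to the polynomials `f`, `g`. -/
def gamma4 {𝕜 : Type*} [RCLike 𝕜] (a : ℝ → 𝕜) (y : ℝ) (f g : ℝ[X]) : 𝕜 :=
  1 / 2 * ∫ x in Set.Iic y, gammaIntegrand4 a f g x

end GaussianEnsemble

end

/-! The fourth power of a Vandermonde product is a confluent Vandermonde determinant. For the `2N`
points `x_i`, `x_i + h`, the determinant of the values of the monic `Q_j` is `h ^ N` times a product
tending to `∏ (x_j - x_i) ^ 4`. Antisymmetrising its Leibniz sum within each pair of rows, dividing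
by `h ^ N` and letting `h → 0` turns each pair into a Wronskian (`sum_perm_prod_wronskian`). Up to
the weight, the integrand of `γ⁽⁴⁾` is that Wronskian (`gammaIntegrand4_eq`). The integrand of the
average is thus a signed sum of products of one-variable functions; Fubini, term by term, yields the
Pfaffian. -/

/-! ### Algebra: the confluent Vandermonde identity -/

theorem prod_fin_two_mul {R : Type*} [CommMonoid R] {N : ℕ} (F : Fin (2 * N) → R) :
    ∏ r, F r = ∏ i : Fin N, F ⟨2 * i.1, by omega⟩ * F ⟨2 * i.1 + 1, by omega⟩ := by
  induction N with
  | zero => rfl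
  | succ N ih =>
    rw [Fin.prod_univ_castSucc (n := N)]
    refine Eq.trans ?_ (congrArg (· * _) (ih fun r : Fin (2 * N) => F ⟨r.1, by omega⟩))
    change ∏ r : Fin (2 * N + 1 + 1), F r = _
    rw [Fin.prod_univ_castSucc, Fin.prod_univ_castSucc, mul_assoc]
    rfl

/-- A pair `r < s` lies either inside one block `{2i, 2i+1}` or across two blocks `i < j`, where all
four choices occur. -/
theorem prod_Ioi_fin_two_mul {R : Type*} [CommMonoid R] {N : ℕ}
    (F : Fin (2 * N) → Fin (2 * N) → R) :
    ∏ r, ∏ s ∈ Finset.Ioi r, F r s =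
      (∏ i : Fin N, F ⟨2 * i.1, by omega⟩ ⟨2 * i.1 + 1, by omega⟩) *
        ∏ i : Fin N, ∏ j ∈ Finset.Ioi i,
          (F ⟨2 * i.1, by omega⟩ ⟨2 * j.1, by omega⟩ *
              F ⟨2 * i.1, by omega⟩ ⟨2 * j.1 + 1, by omega⟩ *
            (F ⟨2 * i.1 + 1, by omega⟩ ⟨2 * j.1, by omega⟩ *
              F ⟨2 * i.1 + 1, by omega⟩ ⟨2 * j.1 + 1, by omega⟩)) := by
  have hI : ∀ {n : ℕ} (r : Fin n) (G : Fin n → R),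
      ∏ s ∈ Finset.Ioi r, G s = ∏ s, if r < s then G s else 1 := by
    intro n r G
    rw [← Finset.prod_filter]
    congr 1
    ext s
    simp
  simp only [hI]
  rw [prod_fin_two_mul, ← Finset.prod_mul_distrib]
  refine Finset.prod_congr rfl fun i _ => ?_
  rw [prod_fin_two_mul, prod_fin_two_mul, ← Finset.prod_mul_distrib]
  have h1 : F ⟨2 * i.1, by omega⟩ ⟨2 * i.1 + 1, by omega⟩ =
      ∏ j : Fin N, if i = j then F ⟨2 * i.1, by omega⟩ ⟨2 * j.1 + 1, by omega⟩ else 1 := by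
    simp
  rw [h1, ← Finset.prod_mul_distrib]
  refine Finset.prod_congr rfl fun j _ => ?_
  simp only [Fin.lt_def, Fin.ext_iff]
  rcases lt_trichotomy i.1 j.1 with h | h | h
  · rw [if_pos (by omega), if_pos (by omega), if_pos (by omega), if_pos (by omega),
      if_neg (by omega), if_pos h, one_mul]
  · rw [if_neg (by omega), if_pos (by omega), if_neg (by omega), if_neg (by omega),
      if_pos h, if_neg (by omega)]
    simp
  · rw [if_neg (by omega), if_neg (by omega), if_neg (by omega), if_neg (by omega),
      if_neg (by omega), if_neg (by omega)]
    simp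

/-- Antisymmetrising one by one the factors of a Pfaffian-type sum multiplies it by a power of
two. -/
theorem sum_perm_antisymm_subset {R : Type*} [CommRing R] {N : ℕ}
    (A : Fin N → Fin (2 * N) → Fin (2 * N) → R) (s : Finset (Fin N)) :
    ∑ P : Equiv.Perm (Fin (2 * N)), ((Equiv.Perm.sign P : ℤ) : R) *
        ((∏ i ∈ s, (A i (P ⟨2 * i.1, by omega⟩) (P ⟨2 * i.1 + 1, by omega⟩) -
          A i (P ⟨2 * i.1 + 1, by omega⟩) (P ⟨2 * i.1, by omega⟩))) *
        ∏ i ∈ sᶜ, A i (P ⟨2 * i.1, by omega⟩) (P ⟨2 * i.1 + 1, by omega⟩)) =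
      2 ^ s.card * ∑ P : Equiv.Perm (Fin (2 * N)), ((Equiv.Perm.sign P : ℤ) : R) *
        ∏ i, A i (P ⟨2 * i.1, by omega⟩) (P ⟨2 * i.1 + 1, by omega⟩) := by
  induction s using Finset.induction_on with
  | empty => simp
  | insert m s hm ih =>
    rw [Finset.card_insert_of_notMem hm, pow_succ', mul_assoc, ← ih]
    have hc : sᶜ = insert m (insert m s)ᶜ := by
      ext i
      by_cases h : i = m <;> simp [h, hm]
    have hm' : m ∉ (insert m s)ᶜ := by simp
    simp only [hc, Finset.prod_insert hm, Finset.prod_insert hm']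
    have h2 : ∀ z : R, 2 * z = z + z := two_mul
    simp only [sub_mul, mul_sub, Finset.sum_sub_distrib, h2]
    rw [sub_eq_add_neg]
    congr 1
    · exact Finset.sum_congr rfl fun P _ => by ring
    rw [← Finset.sum_neg_distrib]
    have hne : (⟨2 * m.1, by omega⟩ : Fin (2 * N)) ≠ ⟨2 * m.1 + 1, by omega⟩ := by simp
    -- Precomposing `P` with the transposition of block `m` flips the sign and exchanges the two
    -- terms of factor `m`, leaving the other factors alone.
    refine Fintype.sum_equiv (Equiv.mulRight (Equiv.swap ⟨2 * m.1, by omega⟩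
      ⟨2 * m.1 + 1, by omega⟩)) _ _ fun P => ?_
    have ho : ∀ i : Fin N, i ≠ m →
        Equiv.swap (⟨2 * m.1, by omega⟩ : Fin (2 * N)) ⟨2 * m.1 + 1, by omega⟩
          ⟨2 * i.1, by omega⟩ = ⟨2 * i.1, by omega⟩ ∧
        Equiv.swap (⟨2 * m.1, by omega⟩ : Fin (2 * N)) ⟨2 * m.1 + 1, by omega⟩
          ⟨2 * i.1 + 1, by omega⟩ = ⟨2 * i.1 + 1, by omega⟩ := by
      intro i hi
      have hi' : i.1 ≠ m.1 := fun h => hi (Fin.ext h)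
      constructor <;> apply Equiv.swap_apply_of_ne_of_ne <;> simp [Fin.ext_iff] <;> omega
    simp only [Equiv.coe_mulRight, Equiv.Perm.sign_mul, Equiv.Perm.sign_swap hne,
      Equiv.Perm.coe_mul, Function.comp_apply, Equiv.swap_apply_left, Equiv.swap_apply_right]
    conv_rhs => rw [Finset.prod_congr (s₁ := s) rfl fun i hi => by
        rw [(ho i fun h => hm (h ▸ hi)).1, (ho i fun h => hm (h ▸ hi)).2],
      Finset.prod_congr (s₁ := (insert m s)ᶜ) rfl fun i hi => by
        rw [(ho i fun h => hm' (h ▸ hi)).1, (ho i fun h => hm' (h ▸ hi)).2]]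
    push_cast
    ring

theorem sum_perm_antisymm {R : Type*} [CommRing R] {N : ℕ}
    (A : Fin N → Fin (2 * N) → Fin (2 * N) → R) :
    ∑ P : Equiv.Perm (Fin (2 * N)), ((Equiv.Perm.sign P : ℤ) : R) *
        ∏ i, (A i (P ⟨2 * i.1, by omega⟩) (P ⟨2 * i.1 + 1, by omega⟩) -
          A i (P ⟨2 * i.1 + 1, by omega⟩) (P ⟨2 * i.1, by omega⟩)) =
      2 ^ N * ∑ P : Equiv.Perm (Fin (2 * N)), ((Equiv.Perm.sign P : ℤ) : R) *
        ∏ i, A i (P ⟨2 * i.1, by omega⟩) (P ⟨2 * i.1 + 1, by omega⟩) := by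
  simpa using sum_perm_antisymm_subset A Finset.univ

/-- The Vandermonde determinant of the points `x_i`, `x_i + h`, expanded in pairs of rows. -/
theorem sum_perm_prod_eval_add {N : ℕ} (Q : ℕ → ℝ[X]) (hm : ∀ j, (Q j).Monic)
    (hd : ∀ j, (Q j).natDegree = j) (x : Fin N → ℝ) (h : ℝ) :
    ∑ P : Equiv.Perm (Fin (2 * N)), ((Equiv.Perm.sign P : ℤ) : ℝ) *
        ∏ i, ((Q (P ⟨2 * i.1, by omega⟩)).eval (x i) *
          (Q (P ⟨2 * i.1 + 1, by omega⟩)).eval (x i + h)) =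
      h ^ N * ∏ i : Fin N, ∏ j ∈ Finset.Ioi i,
        ((x j - x i) ^ 2 * ((x j - x i) ^ 2 - h ^ 2)) := by
  -- The points in the order `x_0, x_0 + h, x_1, x_1 + h, …`. Each block contributes a factor `h`;
  -- two blocks at distance `d` contribute `d · (d + h) · (d - h) · d`.
  let v : Fin (2 * N) → ℝ := fun r =>
    if r.1 % 2 = 0 then x ⟨r.1 / 2, by omega⟩ else x ⟨r.1 / 2, by omega⟩ + h
  have hv0 : ∀ i : Fin N, v ⟨2 * i.1, by omega⟩ = x i := fun i => by simp [v]
  have hv1 : ∀ i : Fin N, v ⟨2 * i.1 + 1, by omega⟩ = x i + h := fun i => by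
    have : (2 * i.1 + 1) / 2 = i.1 := by omega
    simp [v, this, Nat.add_mod]
  have key := Matrix.det_eval_matrixOfPolynomials_eq_det_vandermonde v
    (fun j : Fin (2 * N) => Q j) (fun j => hd j) (fun j => hm j)
  rw [Matrix.det_vandermonde, prod_Ioi_fin_two_mul, ← Matrix.det_transpose,
    Matrix.det_apply'] at key
  simp only [Matrix.transpose_apply, Matrix.of_apply, prod_fin_two_mul, hv0, hv1] at key
  rw [← key]
  congr 1
  · simp
  · exact Finset.prod_congr rfl fun i _ => Finset.prod_congr rfl fun j _ => by ring

/-- The fourth power of the Vandermonde product as a Pfaffian-type sum of Wronskians. -/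
theorem sum_perm_prod_wronskian {N : ℕ} (Q : ℕ → ℝ[X]) (hm : ∀ j, (Q j).Monic)
    (hd : ∀ j, (Q j).natDegree = j) (x : Fin N → ℝ) :
    ∑ P : Equiv.Perm (Fin (2 * N)), ((Equiv.Perm.sign P : ℤ) : ℝ) *
        ∏ i, (Polynomial.wronskian (Q (P ⟨2 * i.1, by omega⟩))
          (Q (P ⟨2 * i.1 + 1, by omega⟩))).eval (x i) =
      2 ^ N * ∏ i : Fin N, ∏ j ∈ Finset.Ioi i, (x j - x i) ^ 4 := by
  have hlim : ∀ (f g : ℝ[X]) (t : ℝ), Filter.Tendsto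
      (fun h : ℝ => h⁻¹ * (f.eval t * g.eval (t + h) - g.eval t * f.eval (t + h)))
      (nhdsWithin 0 {0}ᶜ) (nhds ((Polynomial.wronskian f g).eval t)) := by
    intro f g t
    -- This function vanishes at `u = t`, so its difference quotient there is exactly the expression
    -- in `hlim`.
    have hd : HasDerivAt (fun u => f.eval t * g.eval u - g.eval t * f.eval u)
        ((Polynomial.wronskian f g).eval t) t := by
      refine (((g.hasDerivAt t).const_mul (f.eval t)).fun_sub
        ((f.hasDerivAt t).const_mul (g.eval t))).congr_deriv ?_
      rw [Polynomial.wronskian, Polynomial.eval_sub, Polynomial.eval_mul, Polynomial.eval_mul]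
      ring
    refine hd.tendsto_slope_zero.congr fun h => ?_
    simp only [smul_eq_mul]
    ring
  have hL : Filter.Tendsto (fun h : ℝ => ∑ P : Equiv.Perm (Fin (2 * N)),
      ((Equiv.Perm.sign P : ℤ) : ℝ) * ∏ i, (h⁻¹ *
        ((Q (P ⟨2 * i.1, by omega⟩)).eval (x i) *
            (Q (P ⟨2 * i.1 + 1, by omega⟩)).eval (x i + h) -
          (Q (P ⟨2 * i.1 + 1, by omega⟩)).eval (x i) *
            (Q (P ⟨2 * i.1, by omega⟩)).eval (x i + h)))) (nhdsWithin 0 {0}ᶜ)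
      (nhds (∑ P : Equiv.Perm (Fin (2 * N)), ((Equiv.Perm.sign P : ℤ) : ℝ) *
        ∏ i, (Polynomial.wronskian (Q (P ⟨2 * i.1, by omega⟩))
          (Q (P ⟨2 * i.1 + 1, by omega⟩))).eval (x i))) :=
    tendsto_finsetSum _ fun P _ => (tendsto_finsetProd _ fun i _ => hlim _ _ _).const_mul _
  have hR : Filter.Tendsto (fun h : ℝ => 2 ^ N * ∏ i : Fin N, ∏ j ∈ Finset.Ioi i,
      ((x j - x i) ^ 2 * ((x j - x i) ^ 2 - h ^ 2))) (nhdsWithin 0 {0}ᶜ)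
      (nhds (2 ^ N * ∏ i : Fin N, ∏ j ∈ Finset.Ioi i, (x j - x i) ^ 4)) := by
    have hc : Continuous fun h : ℝ => 2 ^ N * ∏ i : Fin N, ∏ j ∈ Finset.Ioi i,
      ((x j - x i) ^ 2 * ((x j - x i) ^ 2 - h ^ 2)) := by fun_prop
    convert (hc.tendsto 0).mono_left nhdsWithin_le_nhds using 3
    refine Finset.prod_congr rfl fun i _ => Finset.prod_congr rfl fun j _ => by ring
  refine tendsto_nhds_unique hL (hR.congr' ?_)
  -- For `h ≠ 0` both sides agree exactly: antisymmetrisation supplies `2 ^ N`, and `h⁻¹ ^ N`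
  -- cancels the `h ^ N` of the determinant.
  filter_upwards [self_mem_nhdsWithin] with h hh
  have hh : h ≠ 0 := hh
  have e1 := sum_perm_antisymm fun (i : Fin N) (j k : Fin (2 * N)) =>
    (Q j).eval (x i) * (Q k).eval (x i + h)
  rw [sum_perm_prod_eval_add Q hm hd] at e1
  simp only [Finset.prod_mul_distrib, Finset.prod_const, Finset.card_univ, Fintype.card_fin,
    mul_left_comm _ (h⁻¹ ^ N), ← Finset.mul_sum] at e1 ⊢
  rw [e1, inv_pow, ← mul_assoc, ← mul_assoc, ← mul_assoc]
  field_simp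

/-! ### Analysis: integrability, Fubini and positivity -/

namespace GaussianEnsemble

/-- The terms in which the derivative hits the Gaussian are symmetric in `f` and `g`, hence cancel.
-/
theorem gammaIntegrand4_eq {𝕜 : Type*} [RCLike 𝕜] (a : ℝ → 𝕜) (f g : ℝ[X]) (x : ℝ) :
    gammaIntegrand4 a f g x =
      a x * ((Real.exp (-(2 * x ^ 2)) * (Polynomial.wronskian f g).eval x : ℝ) : 𝕜) := by
  have hd : ∀ p : ℝ[X], deriv (fun t => Real.exp (-t ^ 2) * p.eval t) x =
      Real.exp (-x ^ 2) * (-(2 * x)) * p.eval x + Real.exp (-x ^ 2) * p.derivative.eval x := by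
    intro p
    have h1 : HasDerivAt (fun t : ℝ => -t ^ 2) (-(2 * x)) x := by
      simpa using (hasDerivAt_pow 2 x).fun_neg
    exact (h1.exp.mul (p.hasDerivAt x)).deriv
  have he : Real.exp (-(2 * x ^ 2)) = Real.exp (-x ^ 2) * Real.exp (-x ^ 2) := by
    rw [← Real.exp_add]
    ring_nf
  rw [gammaIntegrand4, hd, hd, he]
  congr 2
  simp only [Polynomial.wronskian, Polynomial.eval_sub, Polynomial.eval_mul]
  ring

theorem integrable_mul_exp_mul_eval {𝕜 : Type*} [RCLike 𝕜] {μ : Measure ℝ} {n : ℕ} {a : ℝ → 𝕜}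
    (ha : ∀ k : ℕ, k + 4 ≤ n →
      Integrable (fun x : ℝ => a x * ((x ^ k * Real.exp (-(2 * x ^ 2)) : ℝ) : 𝕜)) μ)
    {p : ℝ[X]} (hp : p ≠ 0 → p.natDegree + 4 ≤ n) :
    Integrable (fun x => a x * ((Real.exp (-(2 * x ^ 2)) * p.eval x : ℝ) : 𝕜)) μ := by
  by_cases h0 : p = 0
  · simp [h0]
  have hsum : Integrable (fun x => ∑ k ∈ Finset.range (p.natDegree + 1), (p.coeff k : 𝕜) *
      (a x * ((x ^ k * Real.exp (-(2 * x ^ 2)) : ℝ) : 𝕜))) μ :=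
    integrable_finsetSum _ fun k hk => (ha k (by
      have := hp h0
      have := Finset.mem_range.1 hk
      omega)).const_mul _
  refine hsum.congr (ae_of_all _ fun x => ?_)
  simp only [Polynomial.eval_eq_sum_range, Finset.mul_sum]
  push_cast
  rw [Finset.mul_sum]
  exact Finset.sum_congr rfl fun k _ => by ring

/-- This is why moments up to `4N - 4` suffice: distinct indices below `2N` sum to at most `4N - 3`,
and a nonzero Wronskian has degree strictly below the sum of the degrees. -/
theorem natDegree_wronskian_add_four_le {Q : ℕ → ℝ[X]} (hd : ∀ j, (Q j).natDegree = j) {N : ℕ}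
    (j k : Fin (2 * N)) (hw : Polynomial.wronskian (Q j) (Q k) ≠ 0) :
    (Polynomial.wronskian (Q j) (Q k)).natDegree + 4 ≤ 4 * N := by
  have hjk : j.1 ≠ k.1 := fun h => hw (by rw [h, Polynomial.wronskian_self_eq_zero])
  have := Polynomial.natDegree_wronskian_lt_add hw
  rw [hd, hd] at this
  omega

theorem integrable_gammaIntegrand4 {𝕜 : Type*} [RCLike 𝕜] {μ : Measure ℝ} {N : ℕ} {a : ℝ → 𝕜}
    (ha : ∀ k : ℕ, k + 4 ≤ 4 * N →
      Integrable (fun x : ℝ => a x * ((x ^ k * Real.exp (-(2 * x ^ 2)) : ℝ) : 𝕜)) μ)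
    {Q : ℕ → ℝ[X]} (hd : ∀ j, (Q j).natDegree = j) (j k : Fin (2 * N)) :
    Integrable (gammaIntegrand4 a (Q j) (Q k)) μ := by
  simpa only [← gammaIntegrand4_eq] using
    integrable_mul_exp_mul_eval ha (natDegree_wronskian_add_four_le hd j k)

theorem averageIntegrand_four_eq {𝕜 : Type*} [RCLike 𝕜] {N : ℕ} (a : ℝ → 𝕜) {Q : ℕ → ℝ[X]}
    (hm : ∀ j, (Q j).Monic) (hd : ∀ j, (Q j).natDegree = j) (x : Fin N → ℝ) :
    averageIntegrand 4 N a x = (2 ^ N)⁻¹ * ∑ P : Equiv.Perm (Fin (2 * N)),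
      ((Equiv.Perm.sign P : ℤ) : 𝕜) * ∏ i : Fin N,
        gammaIntegrand4 a (Q (P ⟨2 * i.1, by omega⟩)) (Q (P ⟨2 * i.1 + 1, by omega⟩)) (x i) := by
  have hw := congrArg (RCLike.ofReal (K := 𝕜)) (sum_perm_prod_wronskian Q hm hd x)
  have he : eigenvalueWeight 4 N x = (∏ i, Real.exp (-(2 * x i ^ 2))) *
      ∏ i : Fin N, ∏ j ∈ Finset.Ioi i, (x j - x i) ^ 4 := by
    rw [eigenvalueWeight]
    congr 1
    · refine Finset.prod_congr rfl fun i _ => ?_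
      congr 1
      push_cast
      ring
    · exact Finset.prod_congr rfl fun i _ => Finset.prod_congr rfl fun j _ =>
        Even.pow_abs (by decide) _
  have hP : ∀ P : Equiv.Perm (Fin (2 * N)), ((Equiv.Perm.sign P : ℤ) : 𝕜) * ∏ i : Fin N,
      gammaIntegrand4 a (Q (P ⟨2 * i.1, by omega⟩)) (Q (P ⟨2 * i.1 + 1, by omega⟩)) (x i) =
      ((∏ i, a (x i)) * ∏ i, ((Real.exp (-(2 * x i ^ 2)) : ℝ) : 𝕜)) *
        (((Equiv.Perm.sign P : ℤ) : 𝕜) * ∏ i : Fin N,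
          (((Polynomial.wronskian (Q (P ⟨2 * i.1, by omega⟩))
            (Q (P ⟨2 * i.1 + 1, by omega⟩))).eval (x i) : ℝ) : 𝕜)) := fun P => by
    simp only [gammaIntegrand4_eq, RCLike.ofReal_mul, Finset.prod_mul_distrib]
    ring
  simp only [hP, ← Finset.mul_sum]
  rw [averageIntegrand, he]
  push_cast at hw ⊢
  rw [hw]
  field_simp

theorem integrable_averageIntegrand_four {𝕜 : Type*} [RCLike 𝕜] {μ : Measure ℝ} [SigmaFinite μ]
    {N : ℕ} {a : ℝ → 𝕜} {Q : ℕ → ℝ[X]} (hm : ∀ j, (Q j).Monic) (hd : ∀ j, (Q j).natDegree = j)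
    (hint : ∀ j k : Fin (2 * N), Integrable (gammaIntegrand4 a (Q j) (Q k)) μ) :
    Integrable (averageIntegrand 4 N a) (Measure.pi fun _ => μ) := by
  simp only [funext (averageIntegrand_four_eq a hm hd)]
  exact (integrable_finsetSum _ fun P _ =>
    (Integrable.fintype_prod fun i => hint _ _).const_mul _).const_mul _

theorem integral_averageIntegrand_four {𝕜 : Type*} [RCLike 𝕜] {μ : Measure ℝ} [SigmaFinite μ]
    {N : ℕ} {a : ℝ → 𝕜} {Q : ℕ → ℝ[X]} (hm : ∀ j, (Q j).Monic) (hd : ∀ j, (Q j).natDegree = j)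
    (hint : ∀ j k : Fin (2 * N), Integrable (gammaIntegrand4 a (Q j) (Q k)) μ) :
    ∫ x, averageIntegrand 4 N a x ∂(Measure.pi fun _ => μ) =
      (2 ^ N)⁻¹ * ∑ P : Equiv.Perm (Fin (2 * N)), ((Equiv.Perm.sign P : ℤ) : 𝕜) *
        ∏ i : Fin N, ∫ t, gammaIntegrand4 a (Q (P ⟨2 * i.1, by omega⟩))
          (Q (P ⟨2 * i.1 + 1, by omega⟩)) t ∂μ := by
  simp only [averageIntegrand_four_eq a hm hd]
  rw [integral_const_mul, integral_finsetSum _ fun P _ =>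
    (Integrable.fintype_prod fun i => hint _ _).const_mul _]
  simp only [integral_const_mul]
  congr 1
  exact Finset.sum_congr rfl fun P _ => by rw [integral_fintype_prod_eq_prod]

/-- Integrability of the weight is the case `a = 1`, `Q_j = X ^ j` of the general result, over the
whole line. -/
theorem partitionZ_four_pos (N : ℕ) : 0 < partitionZ 4 N := by
  have hmom : ∀ k : ℕ, k + 4 ≤ 4 * N → Integrable (fun x : ℝ =>
      (1 : ℝ) * ((x ^ k * Real.exp (-(2 * x ^ 2)) : ℝ) : ℝ)) := by
    intro k _
    have := integrable_rpow_mul_exp_neg_mul_sq (b := 2) (by norm_num) (s := (k : ℝ))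
      (by linarith [k.cast_nonneg (α := ℝ)])
    simpa using this
  have hint := integrable_averageIntegrand_four (fun j => Polynomial.monic_X_pow j)
    (fun j => Polynomial.natDegree_X_pow j)
    (integrable_gammaIntegrand4 (μ := volume) (N := N) (a := fun _ => (1 : ℝ)) hmom
      (fun j => Polynomial.natDegree_X_pow j))
  have hone : averageIntegrand 4 N (fun _ => (1 : ℝ)) = eigenvalueWeight 4 N := by
    funext x
    simp [averageIntegrand]
  rw [hone] at hint
  -- The weight is continuous and nonnegative, and nonzero at `(0, 1, …, N - 1)` because these
  -- coordinates are distinct.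
  refine integral_pos_of_integrable_nonneg_nonzero (x := fun i : Fin N => (i : ℝ)) ?_ hint ?_ ?_
  · unfold eigenvalueWeight
    fun_prop
  · intro x
    simp only [Pi.zero_apply, eigenvalueWeight]
    positivity
  · refine mul_ne_zero (Finset.prod_ne_zero_iff.2 fun i _ => (Real.exp_pos _).ne')
      (Finset.prod_ne_zero_iff.2 fun i _ => Finset.prod_ne_zero_iff.2 fun j hj => ?_)
    refine pow_ne_zero _ (abs_ne_zero.2 (sub_ne_zero.2 ?_))
    exact fun h => (Finset.mem_Ioi.1 hj).ne' (Fin.ext (Nat.cast_injective h))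

end GaussianEnsemble

theorem mainTheorem5 {𝕜 : Type*} [RCLike 𝕜] (N : ℕ) (y : ℝ) (a : ℝ → 𝕜)
    (ha : ∀ k : ℕ, k + 4 ≤ 4 * N →
      IntegrableOn (fun x : ℝ => a x * ((x ^ k * Real.exp (-(2 * x ^ 2)) : ℝ) : 𝕜)) (Set.Iic y))
    (Q : ℕ → ℝ[X]) (hQ : GaussianEnsemble.IsMonicSkewOrthogonal4 y Q) :
    0 < GaussianEnsemble.partitionZ 4 N ∧
    IntegrableOn (GaussianEnsemble.averageIntegrand 4 N a) (GaussianEnsemble.cutoffBox N y) ∧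
    (∀ j k : Fin (2 * N),
      IntegrableOn (GaussianEnsemble.gammaIntegrand4 a (Q j) (Q k)) (Set.Iic y)) ∧
    GaussianEnsemble.restrictedAverage 4 N a y =
      (((N ! : ℝ) * 2 ^ N / GaussianEnsemble.partitionZ 4 N : ℝ) : 𝕜) *
        GaussianEnsemble.pfaffian
          (Matrix.of fun j k : Fin (2 * N) => GaussianEnsemble.gamma4 a y (Q j) (Q k)) := by
  have hm := hQ.monic
  have hd := hQ.natDegree_eq
  have hint := GaussianEnsemble.integrable_gammaIntegrand4 ha hd
  have hbox : (volume : Measure (Fin N → ℝ)).restrict (GaussianEnsemble.cutoffBox N y) =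
      Measure.pi fun _ => volume.restrict (Set.Iic y) :=
    Measure.restrict_pi_pi (fun _ : Fin N => (volume : Measure ℝ)) fun _ => Set.Iic y
  refine ⟨GaussianEnsemble.partitionZ_four_pos N, ?_, hint, ?_⟩
  · rw [IntegrableOn, hbox]
    exact GaussianEnsemble.integrable_averageIntegrand_four hm hd hint
  · rw [GaussianEnsemble.restrictedAverage, hbox,
      GaussianEnsemble.integral_averageIntegrand_four hm hd hint, GaussianEnsemble.pfaffian]
    -- The `N` factors `1 / 2` of the entries give the `(2 ^ N)⁻¹` of the Wronskian identity; the
    -- prefactor `N! 2 ^ N` cancels the normalisation of the Pfaffian.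
    simp only [Matrix.of_apply, GaussianEnsemble.gamma4, Finset.prod_mul_distrib,
      Finset.prod_const, Finset.card_univ, Fintype.card_fin,
      mul_left_comm _ ((1 / 2 : 𝕜) ^ N), ← Finset.mul_sum]
    have hN : (N ! : 𝕜) ≠ 0 := Nat.cast_ne_zero.2 N.factorial_ne_zero
    have hZ : ((GaussianEnsemble.partitionZ 4 N : ℝ) : 𝕜) ≠ 0 :=
      RCLike.ofReal_ne_zero.2 (GaussianEnsemble.partitionZ_four_pos N).ne'
    push_cast
    rw [one_div_pow]
    field_simp
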